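/- A ring $S$ is called (right) primitive if it has a faithful irreducible right $S$-module. Let $G = A *_H B$ be the free product of groups $A$ and $B$ with common subgroup $H$ amalgamated (i.e. $H$ is embedded in $A$ and in $B$ and $G$ is the pushout), and suppose that $G$ satisfies $(\dagger)$ $B \neq H$, and there exist elements $a, a_* \in A \setminus H$ such that $a a_* \neq 1$ and $a^{-1} H a \cap H = 1$. Then for every domain $R$ (a nonzero, not necessarily commutative, ring without zero divisors) with $|R| \le |G|$, the group ring $RG$ is primitive. In particular, the group algebra $KG$ is primitive for every field $K$, with no restriction on the cardinality of $K$. -/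

import Mathlib

universe u v w

/-- A ring `S` is (right) primitive if it has a faithful irreducible right module. Right `S`-modules
are modules over the opposite ring. An irreducible module is a quotient of `S`, so it is no
restriction to look for `M` in the universe of `S`. -/
def IsRightPrimitive (S : Type u) [Ring S] : Prop :=
  ∃ (M : Type u) (_ : AddCommGroup M) (_ : Module Sᵐᵒᵖ M),
    IsSimpleModule Sᵐᵒᵖ M ∧ FaithfulSMul Sᵐᵒᵖ M

namespace Amalgam

/-- The two-member family of types `A`, `B`. -/
def Factor (A B : Type u) : Bool → Type u
  | false => A
  | true => B

instance instGroupFactor (A B : Type u) [Group A] [Group B] : (i : Bool) → Group (Factor A B i)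
  | false => inferInstanceAs (Group A)
  | true => inferInstanceAs (Group B)

/-- The two-member family of homomorphisms `φ : H →* A`, `ψ : H →* B`. -/
def maps {A B H : Type u} [Group A] [Group B] [Group H] (φ : H →* A) (ψ : H →* B) :
    (i : Bool) → H →* Factor A B i
  | false => φ
  | true => ψ

end Amalgam

/-- The free product `A *_H B` of `A` and `B` with `H` amalgamated along `φ : H →* A` and
`ψ : H →* B`, i.e. the pushout of `φ` and `ψ` in the category of groups. -/
abbrev AmalgamatedProduct {A B H : Type u} [Group A] [Group B] [Group H]
    (φ : H →* A) (ψ : H →* B) : Type u :=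
  Monoid.PushoutI (Amalgam.maps φ ψ)

/-- The condition `(†)` on `A *_H B`, where `H` is identified with its images in `A` and `B`:
`B ≠ H` and there are `a, a' ∈ A \ H` with `a a' ≠ 1` and `a⁻¹ H a ∩ H = 1`. -/
def AmalgamatedProduct.Dagger {A B H : Type u} [Group A] [Group B] [Group H]
    (φ : H →* A) (ψ : H →* B) : Prop :=
  ψ.range ≠ ⊤ ∧
    ∃ a a' : A, a ∉ φ.range ∧ a' ∉ φ.range ∧ a * a' ≠ 1 ∧
      φ.range.map (MulAut.conj a⁻¹).toMonoidHom ⊓ φ.range = ⊥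

/-! Primitivity follows from a proper right ideal `N` such that every nonzero two-sided ideal
contains some `e` with `1 + e ∈ N` (`isRightPrimitive_of_comaximal`). Take nonzero elements `E i`,
at most `|G|` of them, such that every nonzero ideal contains one, and let `N` be generated by the
`1 + e i`, where `e i` is a sum of five two-sided translates `w * E i * y`. Ping-pong on a
half-space `X` (`exists_ping_pong`) chooses them so that products of support elements collide only
through exceptional `g`, each translate having its own exceptional set and these sets being
disjoint. If `1 = ∑ (1 + e i) * β i`, then `∑ e i * β i = 1 - ∑ β i` has too many terms on the left
unless every `β i` vanishes. So `N` is proper.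

If `|R| ≤ |G|`, the `E i` are all nonzero elements of `R[G]`. Over a field the nonzero elements of
the group algebra of the countable prime field suffice, by `exists_mapRange_mem_of_ne_bot`.

In an amalgam, `X` is a half-tree of the Bass–Serre tree: the elements not beginning with a letter
of `A \ H`. The path stabilizer `a⁻¹ H a ∩ H = 1` makes each `u ≠ 1` move some smaller translate of
`X` off itself, and also bounds `|H|` by the index of `H` in `A`, so that coset representatives, or
an infinite sequence, give `|G|` disjoint translates. -/

/-- A subset `X` of a group behaving like a half-space of a sufficiently free action on a tree:
its complement can be moved into it, every nontrivial element moves some translate of `X` inside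
`X` off itself, and there are as many pairwise disjoint translates of `X` as group elements. -/
structure IsHalfSpace {G : Type*} [Group G] (X : Set G) : Prop where
  compress : ∃ b : G, ∀ g ∉ X, b * g ∈ X
  wandering : ∀ u : G, u ≠ 1 → ∃ g : G, (∀ x ∈ X, g * x ∈ X) ∧ ∀ x ∈ X, g⁻¹ * u * g * x ∉ X
  family : ∃ c : G → G, ∀ s t, s ≠ t → ∀ x ∈ X, ∀ y ∈ X, c s * x ≠ c t * y

/-! ### Dynamics of a half-space -/

namespace IsHalfSpace

variable {G : Type*} [Group G] {X : Set G}

/-- Elements are treated one at a time: passing from `g` to `g * k` with `k X ⊆ X` only shrinks the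
translate, so what was already moved off stays off. -/
theorem exists_wandering_finset (hX : IsHalfSpace X) (M : Finset G) (hM : 1 ∉ M) :
    ∃ g : G, ∀ u ∈ M, ∀ x ∈ X, g⁻¹ * u * g * x ∉ X := by
  classical
  induction M using Finset.induction_on with
  | empty => exact ⟨1, by simp⟩
  | insert u M _ ih =>
    simp only [Finset.mem_insert, not_or] at hM
    obtain ⟨g, hg⟩ := ih hM.2
    obtain ⟨k, hk, hk'⟩ := hX.wandering (g⁻¹ * u * g) (by
      intro h
      apply hM.1
      rw [mul_assoc, inv_mul_eq_one] at h
      exact (mul_eq_right.1 h.symm).symm)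
    refine ⟨g * k, fun v hv x hx h ↦ ?_⟩
    rcases Finset.mem_insert.1 hv with rfl | hv
    · exact hk' x hx (by simpa [mul_assoc] using h)
    · refine hg v hv (k * x) (hk x hx) ?_
      simpa [mul_assoc] using hk _ h

theorem exists_separating (hX : IsHalfSpace X) (S : Finset G) :
    ∃ g : G, ∀ s ∈ S, ∀ t ∈ S, ∀ x ∈ X, ∀ y ∈ X, s * (g * x) = t * (g * y) → s = t := by
  classical
  obtain ⟨g, hg⟩ := hX.exists_wandering_finset ((Finset.image₂ (fun s t ↦ t⁻¹ * s) S S).erase 1)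
    (by simp)
  refine ⟨g, fun s hs t ht x hx y hy h ↦ ?_⟩
  by_contra hst
  refine hg (t⁻¹ * s) ?_ x hx ?_
  · rw [Finset.mem_erase]
    exact ⟨fun h ↦ hst (inv_mul_eq_one.1 h).symm, Finset.mem_image₂_of_mem hs ht⟩
  · have : g⁻¹ * (t⁻¹ * s) * g * x = y := by
      simp only [mul_assoc]
      rw [h]
      group
    rwa [this]

/-- The complement of `q X` is pushed into `γ X`, whose translates by `S` are disjoint, and is then
returned into `q X`. -/
theorem exists_ping_pong (hX : IsHalfSpace X) [Infinite G] (S : Finset G) (q : G) :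
    ∃ w y : G, (∀ f ∈ S, ∀ g, q⁻¹ * g ∉ X → q⁻¹ * (w * f * y * g) ∈ X) ∧
      ∀ f ∈ S, ∀ f' ∈ S, ∀ g g', q⁻¹ * g ∉ X → q⁻¹ * g' ∉ X →
        w * f * y * g = w * f' * y * g' → f = f' := by
  classical
  obtain ⟨b, hb⟩ := hX.compress
  obtain ⟨f₀, hf₀⟩ := Infinite.exists_notMem_finset S
  obtain ⟨γ, hγ⟩ := hX.exists_separating (insert f₀ S)
  -- The spare element `f₀ ∉ S` ensures that `f γ X` avoids `f₀ γ X`; hence `γ⁻¹ f₀⁻¹` takes it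
  -- outside `X`, where `b` applies again.
  refine ⟨q * b * γ⁻¹ * f₀⁻¹, γ * b * q⁻¹, fun f hf g hg ↦ ?_, fun f hf f' hf' g g' hg hg' h ↦ ?_⟩
  · have : q⁻¹ * (q * b * γ⁻¹ * f₀⁻¹ * f * (γ * b * q⁻¹) * g) =
        b * (γ⁻¹ * f₀⁻¹ * f * (γ * (b * (q⁻¹ * g)))) := by group
    rw [this]
    refine hb _ fun h ↦ hf₀ ?_
    rw [← hγ f (by simp [hf]) f₀ (by simp) (b * (q⁻¹ * g)) (hb _ hg) _ h (by group)]
    exact hf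
  · refine hγ f (by simp [hf]) f' (by simp [hf']) (b * (q⁻¹ * g)) (hb _ hg)
      (b * (q⁻¹ * g')) (hb _ hg') ?_
    simpa [mul_assoc] using h

/-- A finite set cannot meet infinitely many pairwise disjoint translates. -/
theorem exists_translate_disjoint (hX : IsHalfSpace X) [Infinite G] (S : Finset G) :
    ∃ q : G, ∀ s ∈ S, q⁻¹ * s ∉ X := by
  classical
  obtain ⟨c, hc⟩ := hX.family
  by_contra! h
  choose f hf hf' using fun t ↦ h (c t)
  refine not_injective_infinite_finite (fun t ↦ (⟨f t, hf t⟩ : S)) fun s t hst ↦ ?_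
  by_contra hne
  refine hc s t hne _ (hf' s) _ (hf' t) ?_
  simpa using hst

theorem exists_uniqueMul (hX : IsHalfSpace X) [Infinite G] (S : Finset G) :
    ∃ x : G, ∀ g ∈ S, ∀ h ∈ S, ∀ g' ∈ S, ∀ h' ∈ S,
      g * x * h = g' * x * h' → g = g' ∧ h = h' := by
  obtain ⟨b, hb⟩ := hX.compress
  obtain ⟨γ, hγ⟩ := hX.exists_separating S
  obtain ⟨q, hq⟩ := hX.exists_translate_disjoint S
  refine ⟨γ * b * q⁻¹, fun g hg h hh g' hg' h' hh' heq ↦ ?_⟩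
  have := hγ g hg g' hg' (b * (q⁻¹ * h)) (hb _ (hq h hh)) (b * (q⁻¹ * h')) (hb _ (hq h' hh'))
    (by simpa [mul_assoc] using heq)
  subst this
  exact ⟨rfl, by simpa using heq⟩

end IsHalfSpace

/-! ### Counting terms of sums of products -/

namespace MonoidAlgebra

variable {R : Type*} {G : Type*} [Ring R] [Group G]

theorem card_support_add_le (x y : MonoidAlgebra R G) :
    (x + y).coeff.support.card ≤ x.coeff.support.card + y.coeff.support.card := by
  classical
  rw [coeff_add]
  exact (Finset.card_le_card Finsupp.support_add).trans (Finset.card_union_le _ _)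

theorem card_support_sum_le {ι : Type*} (T : Finset ι) (x : ι → MonoidAlgebra R G) :
    (∑ t ∈ T, x t).coeff.support.card ≤ ∑ t ∈ T, (x t).coeff.support.card := by
  classical
  induction T using Finset.induction_on with
  | empty => simp
  | insert a T ha ih =>
    rw [Finset.sum_insert ha, Finset.sum_insert ha]
    exact (card_support_add_le _ _).trans (by lia)

theorem card_support_mul_le (x y : MonoidAlgebra R G) :
    (x * y).coeff.support.card ≤ x.coeff.support.card * y.coeff.support.card := by
  classical
  exact (Finset.card_le_card (support_coeff_mul_subset x y)).trans Finset.card_mul_le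

theorem support_single_mul_mul_single (x : MonoidAlgebra R G) (w y : G) :
    (single w 1 * x * single y 1).coeff.support =
      x.coeff.support.map ((mulLeftEmbedding w).trans (mulRightEmbedding y)) := by
  rw [support_coeff_mul_single _ _ (by simp), support_coeff_single_mul _ _ (by simp),
    Finset.map_map]

/-- A sum of products without any coincidences has the expected number of terms. -/
theorem card_support_sum_mul_of_unique [NoZeroDivisors R] {ι : Type*} (T : Finset ι)
    (p β : ι → MonoidAlgebra R G)
    (h : ∀ t ∈ T, ∀ t' ∈ T, ∀ f ∈ (p t).coeff.support, ∀ f' ∈ (p t').coeff.support,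
      ∀ g ∈ (β t).coeff.support, ∀ g' ∈ (β t').coeff.support,
        f * g = f' * g' → t = t' ∧ f = f') :
    ∑ t ∈ T, (p t).coeff.support.card * (β t).coeff.support.card ≤
      (∑ t ∈ T, p t * β t).coeff.support.card := by
  classical
  let D := T.sigma fun t ↦ (p t).coeff.support ×ˢ (β t).coeff.support
  have hD : D.card = ∑ t ∈ T, (p t).coeff.support.card * (β t).coeff.support.card := by
    simp [D]
  rw [← hD]
  refine Finset.card_le_card_of_injOn (fun d ↦ d.2.1 * d.2.2) ?_ ?_
  · rintro ⟨t, f, g⟩ hd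
    simp only [D, Finset.coe_sigma, Set.mem_sigma_iff, Finset.mem_coe, Finset.mem_product] at hd
    obtain ⟨ht, hf, hg⟩ := hd
    rw [Finset.mem_coe, Finsupp.mem_support_iff, coeff_sum, Finset.sum_apply',
      Finset.sum_eq_single_of_mem t ht]
    · rw [coeff_mul_mul_of_uniqueMul]
      · exact mul_ne_zero (Finsupp.mem_support_iff.1 hf) (Finsupp.mem_support_iff.1 hg)
      · intro f' g' hf' hg' heq
        obtain ⟨-, rfl⟩ := h t ht t ht f' hf' f hf g' hg' g hg heq
        exact ⟨rfl, mul_left_cancel heq⟩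
    · intro t' ht' hne
      by_contra h0
      obtain ⟨f', hf', g', hg', heq⟩ := Finset.mem_mul.1
        (support_coeff_mul_subset (p t') (β t') (Finsupp.mem_support_iff.2 h0))
      exact hne (h t' ht' t ht f' hf' f hf g' hg' g hg heq).1
  · rintro ⟨t, f, g⟩ hd ⟨t', f', g'⟩ hd' heq
    simp only [D, Finset.coe_sigma, Set.mem_sigma_iff, Finset.mem_coe, Finset.mem_product]
      at hd hd' heq
    obtain ⟨rfl, rfl⟩ := h t hd.1 t' hd'.1 f hd.2.1 f' hd'.2.1 g hd.2.2 g' hd'.2.2 heq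
    rw [mul_left_cancel heq]

open Classical in
/-- A lower bound for the number of terms of a sum of products in which coincidences occur only at
terms of `β t` lying in `Q t`. -/
theorem card_support_sum_mul_ge [NoZeroDivisors R] {ι : Type*} (T : Finset ι)
    (p β : ι → MonoidAlgebra R G) (Q : ι → Set G)
    (h : ∀ t ∈ T, ∀ t' ∈ T, ∀ f ∈ (p t).coeff.support, ∀ f' ∈ (p t').coeff.support,
      ∀ g ∉ Q t, ∀ g' ∉ Q t', f * g = f' * g' → t = t' ∧ f = f') :
    ∑ t ∈ T, (p t).coeff.support.card * (β t).coeff.support.card ≤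
      (∑ t ∈ T, p t * β t).coeff.support.card +
        2 * ∑ t ∈ T, (p t).coeff.support.card * ((β t).coeff.support.filter (· ∈ Q t)).card := by
  let good t : MonoidAlgebra R G := ofCoeff ((β t).coeff.filter (· ∉ Q t))
  let bad t : MonoidAlgebra R G := ofCoeff ((β t).coeff.filter (· ∈ Q t))
  have hgood t : (good t).coeff.support = (β t).coeff.support.filter (· ∉ Q t) :=
    Finsupp.support_filter _ _
  have hbad t : (bad t).coeff.support = (β t).coeff.support.filter (· ∈ Q t) :=
    Finsupp.support_filter _ _
  have hsplit t : β t = bad t + good t := by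
    apply coeff_injective
    exact (Finsupp.filter_add_filter_not _ _).symm
  have h1 := card_support_sum_mul_of_unique T p good (by
    intro t ht t' ht' f hf f' hf' g hg g' hg'
    rw [hgood, Finset.mem_filter] at hg hg'
    exact h t ht t' ht' f hf f' hf' g hg.2 g' hg'.2)
  have h2 : (∑ t ∈ T, p t * bad t).coeff.support.card ≤
      ∑ t ∈ T, (p t).coeff.support.card * ((β t).coeff.support.filter (· ∈ Q t)).card := by
    refine (card_support_sum_le _ _).trans (Finset.sum_le_sum fun t _ ↦ ?_)
    rw [← hbad]
    exact card_support_mul_le _ _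
  have h3 : ∑ t ∈ T, p t * good t = ∑ t ∈ T, p t * β t + -∑ t ∈ T, p t * bad t := by
    simp_rw [hsplit, mul_add, Finset.sum_add_distrib]
    abel
  have h4 := card_support_add_le (∑ t ∈ T, p t * β t) (-∑ t ∈ T, p t * bad t)
  rw [← h3, coeff_neg, Finsupp.support_neg] at h4
  have h5 : ∑ t ∈ T, (p t).coeff.support.card * (β t).coeff.support.card =
      ∑ t ∈ T, (p t).coeff.support.card * ((β t).coeff.support.filter (· ∈ Q t)).card +
      ∑ t ∈ T, (p t).coeff.support.card * (good t).coeff.support.card := by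
    rw [← Finset.sum_add_distrib]
    refine Finset.sum_congr rfl fun t _ ↦ ?_
    rw [hgood, ← mul_add, Finset.card_filter_add_card_filter_not]
  -- The factor 2 arises because bad terms are first left out of the good sum and may then also
  -- cancel good terms.
  lia

end MonoidAlgebra

/-! ### The comaximal right ideal -/

/-- A ring is primitive if it has a proper right ideal comaximal with all nonzero ideals. -/
theorem isRightPrimitive_of_comaximal {S : Type u} [Ring S] (N : Submodule Sᵐᵒᵖ S)
    (h1 : (1 : S) ∉ N) (hN : ∀ I : TwoSidedIdeal S, I ≠ ⊥ → ∃ e ∈ I, 1 + e ∈ N) :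
    IsRightPrimitive S := by
  have hfin : Module.Finite Sᵐᵒᵖ S := by
    refine ⟨⟨{1}, ?_⟩⟩
    rw [eq_top_iff]
    intro x _
    rw [Finset.coe_singleton, Submodule.mem_span_singleton]
    exact ⟨MulOpposite.op x, by simp⟩
  obtain hN' | ⟨m, hm, hNm⟩ := eq_top_or_exists_le_coatom N
  · exact absurd (hN' ▸ Submodule.mem_top) h1
  have h1m : (1 : S) ∉ m := by
    intro h
    refine hm.1 (eq_top_iff.2 fun x _ ↦ ?_)
    simpa using m.smul_mem (MulOpposite.op x) h
  refine ⟨S ⧸ m, inferInstance, inferInstance, isSimpleModule_iff_isCoatom.2 hm, ⟨?_⟩⟩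
  intro r s hrs
  -- `I` is the annihilator of `S ⧸ m`; were it nonzero, it would contain `e` with `e` and `1 + e`
  -- both in `m`.
  let I : TwoSidedIdeal S := .mk' {t | ∀ x, x * t ∈ m} (by simp)
    (fun {a b} ha hb x ↦ by rw [mul_add]; exact m.add_mem (ha x) (hb x))
    (fun {a} ha x ↦ by rw [mul_neg]; exact m.neg_mem (ha x))
    (fun {a b} hb x ↦ by rw [← mul_assoc]; exact hb _)
    (fun {a b} ha x ↦ by
      rw [← mul_assoc]; exact m.smul_mem (MulOpposite.op b) (ha x))
  have hI t : t ∈ I ↔ ∀ x, x * t ∈ m := TwoSidedIdeal.mem_mk' ..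
  have hmem : r.unop - s.unop ∈ I := by
    rw [hI]
    intro x
    have := hrs (m.mkQ x)
    rw [← map_smul, ← map_smul, ← sub_eq_zero, ← map_sub, ← LinearMap.mem_ker,
      Submodule.ker_mkQ] at this
    simpa [mul_sub] using this
  by_contra hne
  obtain ⟨e, he, heN⟩ := hN I (by
    intro h
    rw [h, TwoSidedIdeal.mem_bot, sub_eq_zero] at hmem
    exact hne (MulOpposite.unop_injective hmem))
  refine h1m ?_
  have := m.sub_mem (hNm heN) ((hI e).1 he 1)
  simpa using this

namespace IsHalfSpace

/-- If the nonzero ideals of `R[G]` all contain an element of a family of nonzero elements indexed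
by a set no larger than `G`, then `R[G]` is primitive. -/
theorem isRightPrimitive_of_family {R : Type v} {G : Type u} [Ring R] [IsDomain R] [Group G]
    [Infinite G] {X : Set G} (hX : IsHalfSpace X) {ι : Type w} (E : ι → MonoidAlgebra R G)
    (hE : ∀ i, E i ≠ 0)
    (hcard : Cardinal.lift.{u} (Cardinal.mk ι) ≤ Cardinal.lift.{w} (Cardinal.mk G))
    (hI : ∀ I : TwoSidedIdeal (MonoidAlgebra R G), I ≠ ⊥ → ∃ i, E i ∈ I) :
    IsRightPrimitive (MonoidAlgebra R G) := by
  classical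
  obtain ⟨c, hc⟩ := hX.family
  -- With `X = ∑ |E i| |β i|`, the count below reads `5 X ≤ 1 + X + 2 X`, forcing `X = 0`; four
  -- copies would only give `X ≤ 1`.
  obtain ⟨j⟩ : Nonempty (ι × Fin 5 ↪ G) := by
    rw [← Cardinal.lift_mk_le']
    simp only [Cardinal.mk_prod, Cardinal.lift_mul, Cardinal.lift_uzero,
      Cardinal.mk_fintype, Fintype.card_fin, Cardinal.lift_natCast]
    refine Cardinal.mul_le_of_le (by simp) hcard ?_
    exact (Cardinal.natCast_lt_aleph0.le).trans (by simp)
  choose w y hw hwy using fun t : ι × Fin 5 ↦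
    hX.exists_ping_pong (E t.1).coeff.support (c (j t))
  let p (t : ι × Fin 5) : MonoidAlgebra R G :=
    MonoidAlgebra.single (w t) 1 * E t.1 * MonoidAlgebra.single (y t) 1
  let Q (t : ι × Fin 5) : Set G := {g | (c (j t))⁻¹ * g ∈ X}
  have hQ t t' (g : G) (h : g ∈ Q t) (h' : g ∈ Q t') : t = t' := by
    by_contra hne
    exact hc _ _ (fun h ↦ hne (j.injective h)) _ h _ h' (by simp)
  have hp t : (p t).coeff.support.card = (E t.1).coeff.support.card := by
    rw [MonoidAlgebra.support_single_mul_mul_single, Finset.card_map]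
  have hunique : ∀ t t', ∀ f ∈ (p t).coeff.support, ∀ f' ∈ (p t').coeff.support,
      ∀ g ∉ Q t, ∀ g' ∉ Q t', f * g = f' * g' → t = t' ∧ f = f' := by
    intro t t' f hf f' hf' g hg g' hg' heq
    rw [MonoidAlgebra.support_single_mul_mul_single, Finset.mem_map] at hf hf'
    obtain ⟨f, hf, rfl⟩ := hf
    obtain ⟨f', hf', rfl⟩ := hf'
    simp only [Function.Embedding.trans_apply, mulLeftEmbedding_apply,
      mulRightEmbedding_apply] at heq ⊢
    have := hQ t t' _ (hw t f hf g hg) (heq ▸ hw t' f' hf' g' hg')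
    subst this
    rw [hwy t f hf f' hf' g g' hg hg' heq]
    exact ⟨rfl, rfl⟩
  let e (i : ι) : MonoidAlgebra R G := ∑ k, p (i, k)
  refine isRightPrimitive_of_comaximal
    (Submodule.span (MonoidAlgebra R G)ᵐᵒᵖ (Set.range fun i ↦ 1 + e i)) ?_ ?_
  · intro h1
    rw [Finsupp.mem_span_range_iff_exists_finsupp] at h1
    obtain ⟨b, hb⟩ := h1
    let β (i : ι) : MonoidAlgebra R G := (b i).unop
    let T := b.support ×ˢ (Finset.univ : Finset (Fin 5))
    have hsum : ∑ t ∈ T, p t * β t.1 = 1 + -∑ i ∈ b.support, β i := by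
      rw [← hb, Finsupp.sum, Finset.sum_product, ← sub_eq_add_neg, ← Finset.sum_sub_distrib]
      refine Finset.sum_congr rfl fun i _ ↦ ?_
      change ∑ k, p (i, k) * β i = _
      rw [← Finset.sum_mul, MulOpposite.smul_eq_mul_unop, add_mul, one_mul, add_sub_cancel_left]
    have h2 := MonoidAlgebra.card_support_sum_mul_ge T p (fun t ↦ β t.1) Q
      (fun t _ t' _ ↦ hunique t t')
    have h3 := MonoidAlgebra.card_support_add_le (1 : MonoidAlgebra R G) (-∑ i ∈ b.support, β i)
    have h4 := MonoidAlgebra.card_support_sum_le b.support β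
    rw [MonoidAlgebra.coeff_neg, Finsupp.support_neg, MonoidAlgebra.support_coeff_one,
      Finset.card_one] at h3
    rw [hsum] at h2
    simp only [T, Finset.sum_product, hp] at h2
    simp only [Finset.sum_const, Finset.card_univ, Fintype.card_fin, ← Finset.mul_sum,
      smul_eq_mul] at h2
    -- The five exceptional sets of a given `i` are disjoint, so together they account for each term
    -- of `β i` at most once.
    have h5 : ∑ i ∈ b.support, (E i).coeff.support.card *
        ∑ k, ((β i).coeff.support.filter (· ∈ Q (i, k))).card ≤
        ∑ i ∈ b.support, (E i).coeff.support.card * (β i).coeff.support.card := by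
      refine Finset.sum_le_sum fun i _ ↦ Nat.mul_le_mul_left _ ?_
      rw [← Finset.card_biUnion]
      · exact Finset.card_le_card (Finset.biUnion_subset.2 fun k _ ↦ Finset.filter_subset _ _)
      · intro k _ k' _ hk
        rw [Function.onFun, Finset.disjoint_left]
        intro g hg hg'
        rw [Finset.mem_filter] at hg hg'
        exact hk (Prod.ext_iff.1 (hQ _ _ _ hg.2 hg'.2)).2
    have h6 : ∑ i ∈ b.support, (β i).coeff.support.card ≤
        ∑ i ∈ b.support, (E i).coeff.support.card * (β i).coeff.support.card := by
      refine Finset.sum_le_sum fun i _ ↦ Nat.le_mul_of_pos_left _ ?_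
      rw [Finset.card_pos, Finsupp.support_nonempty_iff, Ne, MonoidAlgebra.coeff_eq_zero]
      exact hE i
    have h7 : ∑ i ∈ b.support, (β i).coeff.support.card = 0 := by lia
    have h8 : b.support = ∅ := by
      rw [Finset.eq_empty_iff_forall_notMem]
      intro i hi
      have := (Finset.sum_eq_zero_iff.1 h7) i hi
      rw [Finset.card_eq_zero, Finsupp.support_eq_empty, MonoidAlgebra.coeff_eq_zero] at this
      exact Finsupp.mem_support_iff.1 hi (MulOpposite.unop_injective this)
    rw [Finsupp.sum, h8, Finset.sum_empty] at hb
    exact zero_ne_one hb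
  · intro I hI'
    obtain ⟨i, hi⟩ := hI I hI'
    refine ⟨e i, I.finsetSum_mem _ _ fun k _ ↦ ?_, Submodule.subset_span ⟨i, rfl⟩⟩
    exact I.mul_mem_right _ _ (I.mul_mem_left _ _ hi)

end IsHalfSpace

/-! ### Descent of ideals to a subfield -/

namespace MonoidAlgebra

theorem coeff_mul_eq_sum_of_subset {R G : Type*} [Semiring R] [Group G] [DecidableEq G]
    {x y : MonoidAlgebra R G} {S T : Finset G} (hS : x.coeff.support ⊆ S)
    (hT : y.coeff.support ⊆ T) (m : G) :
    (x * y).coeff m = ∑ g ∈ S, ∑ h ∈ T, if g * h = m then x.coeff g * y.coeff h else 0 := by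
  rw [coeff_mul, Finsupp.sum_of_support_subset _ hS _ (by simp)]
  refine Finset.sum_congr rfl fun g _ ↦ ?_
  rw [Finsupp.sum_of_support_subset _ hT _ (by simp)]

/-- Let `K / k` be a field extension. If finite subsets of `G` can be multiplied without
coincidences after inserting a suitable element of `G`, then the nonzero ideals of `K[G]` meet
`k[G]` nontrivially. -/
theorem exists_mapRange_mem_of_ne_bot {k K G : Type*} [Field k] [Field K] [Algebra k K] [Group G]
    (hG : ∀ S : Finset G, ∃ x : G, ∀ g ∈ S, ∀ h ∈ S, ∀ g' ∈ S, ∀ h' ∈ S,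
      g * x * h = g' * x * h' → g = g' ∧ h = h')
    (I : TwoSidedIdeal (MonoidAlgebra K G)) (hI : I ≠ ⊥) :
    ∃ y : G →₀ k, y ≠ 0 ∧
      (ofCoeff (y.mapRange (algebraMap k K) (map_zero _)) : MonoidAlgebra K G) ∈ I := by
  classical
  suffices H : ∀ n, ∀ α ∈ I, α ≠ 0 →
      Module.finrank k (Submodule.span k (α.coeff '' α.coeff.support)) = n → ∃ y : G →₀ k, y ≠ 0 ∧
      (ofCoeff (y.mapRange (algebraMap k K) (map_zero _)) : MonoidAlgebra K G) ∈ I by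
    by_contra hcon
    refine hI (eq_bot_iff.2 fun α hα ↦ ?_)
    by_contra hne
    exact hcon (H _ α hα hne rfl)
  intro n
  induction n using Nat.strong_induction_on with
  | _ n ih =>
  intro α hα hne hn
  set V := Submodule.span k (α.coeff '' α.coeff.support) with hV
  have hVfin : Module.Finite k V :=
    Module.Finite.span_of_finite k (α.coeff.support.finite_toSet.image _)
  have hαV g : α.coeff g ∈ V := by
    by_cases h : α.coeff g = 0
    · rw [h]; exact V.zero_mem
    · exact Submodule.subset_span ⟨g, by simpa using h, rfl⟩
  obtain ⟨g₀, hg₀⟩ : ∃ g, α.coeff g ≠ 0 := by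
    by_contra! h
    exact hne (coeff_injective (Finsupp.ext h))
  obtain ⟨l, hl⟩ : ∃ l : Module.Dual k K, l (α.coeff g₀) ≠ 0 := by
    by_contra! h
    exact hg₀ ((Module.forall_dual_apply_eq_zero_iff k _).1 h)
  let y : G →₀ k := α.coeff.mapRange l (map_zero l)
  -- `α₁` is `α` with `l` applied to its coefficients. The coefficients of `α₁ * s * α - α * s * α₁`
  -- lie in `V ⊓ ker l`, so this element of `I` has a smaller coefficient span.
  let α₁ : MonoidAlgebra K G := ofCoeff (y.mapRange (algebraMap k K) (map_zero _))
  have hα₁ g : α₁.coeff g = algebraMap k K (l (α.coeff g)) := rfl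
  have hy : y ≠ 0 := fun h ↦ hl (DFunLike.congr_fun h g₀)
  have hsupp : α₁.coeff.support ⊆ α.coeff.support := by
    intro g hg
    rw [Finsupp.mem_support_iff] at hg ⊢
    intro h
    exact hg (by rw [hα₁, h, map_zero, map_zero])
  obtain ⟨x, hx⟩ := hG α.coeff.support
  let s : MonoidAlgebra K G := single x 1
  let S := α.coeff.support.map (mulRightEmbedding x)
  have hs (z : MonoidAlgebra K G) (g : G) : (z * s).coeff (g * x) = z.coeff g := by
    simp [s]
  have hS : (α * s).coeff.support ⊆ S := by
    rw [support_coeff_mul_single _ _ (by simp)]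
  have hS₁ : (α₁ * s).coeff.support ⊆ S := by
    rw [support_coeff_mul_single _ _ (by simp)]
    exact Finset.map_subset_map.2 hsupp
  have hcoeff (m : G) : (α₁ * s * α - α * s * α₁).coeff m =
      ∑ g ∈ α.coeff.support, ∑ h ∈ α.coeff.support, if g * x * h = m then
        l (α.coeff g) • α.coeff h - l (α.coeff h) • α.coeff g else 0 := by
    rw [coeff_sub, Finsupp.sub_apply, coeff_mul_eq_sum_of_subset hS₁ subset_rfl,
      coeff_mul_eq_sum_of_subset hS hsupp, ← Finset.sum_sub_distrib, Finset.sum_map]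
    refine Finset.sum_congr rfl fun g _ ↦ ?_
    rw [← Finset.sum_sub_distrib]
    refine Finset.sum_congr rfl fun h _ ↦ ?_
    rw [mulRightEmbedding_apply, hs, hs, hα₁, hα₁]
    split_ifs
    · rw [Algebra.smul_def, Algebra.smul_def, mul_comm (α.coeff g)]
    · simp
  have hmem : α₁ * s * α - α * s * α₁ ∈ I :=
    I.sub_mem (I.mul_mem_left _ _ hα) (I.mul_mem_right _ _ (I.mul_mem_right _ _ hα))
  by_cases h0 : α₁ * s * α - α * s * α₁ = 0
  · refine ⟨y, hy, ?_⟩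
    -- By the choice of `x`, only the pair `(g, g₀)` contributes at `g * x * g₀`. Hence `α₁` is a
    -- scalar multiple of `α`.
    have hprop : ∀ g ∈ α.coeff.support,
        l (α.coeff g) • α.coeff g₀ = l (α.coeff g₀) • α.coeff g := by
      intro g hg
      have hg₀' : g₀ ∈ α.coeff.support := Finsupp.mem_support_iff.2 hg₀
      have := hcoeff (g * x * g₀)
      rw [h0, Finset.sum_eq_single_of_mem g hg, Finset.sum_eq_single_of_mem g₀ hg₀', if_pos rfl]
        at this
      · exact (sub_eq_zero.1 this.symm)
      · intro h hh hne
        rw [if_neg]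
        intro heq
        exact hne (hx g hg h hh g hg g₀ hg₀' heq).2
      · intro g' hg' hne
        refine Finset.sum_eq_zero fun h hh ↦ ?_
        rw [if_neg]
        intro heq
        exact hne (hx g' hg' h hh g hg g₀ hg₀' heq).1
    have : α₁ = α * single 1 (algebraMap k K (l (α.coeff g₀)) / α.coeff g₀) := by
      apply coeff_injective
      ext g
      rw [coeff_mul_single_one, hα₁]
      by_cases hg : g ∈ α.coeff.support
      · have := hprop g hg
        rw [Algebra.smul_def, Algebra.smul_def] at this
        field_simp
        rw [this, mul_comm]
      · rw [Finsupp.notMem_support_iff.1 hg]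
        simp
    change α₁ ∈ I
    rw [this]
    exact I.mul_mem_right _ _ hα
  · refine ih _ ?_ _ hmem h0 rfl
    rw [← hn]
    refine Submodule.finrank_lt_finrank_of_lt (lt_of_le_of_lt (b := V ⊓ LinearMap.ker l) ?_ ?_)
    · rw [Submodule.span_le]
      rintro _ ⟨m, -, rfl⟩
      rw [hcoeff]
      refine Submodule.sum_mem _ fun g _ ↦ Submodule.sum_mem _ fun h _ ↦ ?_
      split_ifs
      · refine ⟨V.sub_mem (V.smul_mem _ (hαV _)) (V.smul_mem _ (hαV _)), ?_⟩
        rw [SetLike.mem_coe, LinearMap.mem_ker, map_sub, map_smul, map_smul, smul_eq_mul,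
          smul_eq_mul, mul_comm, sub_self]
      · exact Submodule.zero_mem _
    · refine lt_of_le_of_ne inf_le_left fun h ↦ hl ?_
      have := hαV g₀
      rw [← h] at this
      exact this.2

end MonoidAlgebra

/-! ### Primitivity from a half-space -/

namespace IsHalfSpace

theorem isRightPrimitive_of_card_le {R : Type v} {G : Type u} [Ring R] [IsDomain R] [Group G]
    [Infinite G] {X : Set G} (hX : IsHalfSpace X)
    (hcard : Cardinal.lift.{u} (Cardinal.mk R) ≤ Cardinal.lift.{v} (Cardinal.mk G)) :
    IsRightPrimitive (MonoidAlgebra R G) := by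
  refine hX.isRightPrimitive_of_family (ι := {y : G →₀ R // y ≠ 0})
    (fun y ↦ MonoidAlgebra.ofCoeff y.1) (fun y ↦ by simpa using y.2) ?_ ?_
  · refine (Cardinal.lift_le.2 (Cardinal.mk_subtype_le _)).trans ?_
    rw [Cardinal.mk_finsupp_lift_of_infinite]
    simp only [Cardinal.lift_max, Cardinal.lift_lift, max_le_iff]
    refine ⟨by simp, ?_⟩
    simpa using hcard.trans_eq (congrFun Cardinal.lift_umax.{u, v} _).symm
  · intro I hI
    by_contra! h
    refine hI (eq_bot_iff.2 fun α hα ↦ ?_)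
    by_contra hne
    exact h ⟨α.coeff, fun h ↦ hne (MonoidAlgebra.coeff_eq_zero.1 h)⟩ hα

theorem isRightPrimitive_of_field {K : Type v} {G : Type u} [Field K] [Group G]
    [Infinite G] {X : Set G} (hX : IsHalfSpace X) :
    IsRightPrimitive (MonoidAlgebra K G) := by
  have hk : Cardinal.mk (⊥ : Subfield K) ≤ Cardinal.aleph0 := by
    rw [← Subfield.closure_empty]
    simpa using Subfield.cardinalMk_closure_le_max (∅ : Set K)
  refine hX.isRightPrimitive_of_family (ι := {y : G →₀ (⊥ : Subfield K) // y ≠ 0})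
    (fun y ↦ MonoidAlgebra.ofCoeff (y.1.mapRange (algebraMap _ K) (map_zero _))) ?_ ?_ ?_
  · intro y h
    refine y.2 (Finsupp.ext fun g ↦ ?_)
    have := DFunLike.congr_fun (MonoidAlgebra.ofCoeff_eq_zero.1 h) g
    simpa using this
  · refine (Cardinal.lift_le.2 (Cardinal.mk_subtype_le _)).trans ?_
    rw [Cardinal.mk_finsupp_lift_of_infinite]
    simp only [Cardinal.lift_max, Cardinal.lift_lift, max_le_iff]
    refine ⟨by simp, ?_⟩
    refine (Cardinal.lift_le.2 hk).trans ?_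
    simp
  · intro I hI
    obtain ⟨y, hy, hyI⟩ := MonoidAlgebra.exists_mapRange_mem_of_ne_bot (k := (⊥ : Subfield K))
      hX.exists_uniqueMul I hI
    exact ⟨⟨y, hy⟩, hyI⟩

end IsHalfSpace

/-! ### Reduced words in amalgams -/

namespace Monoid.PushoutI

section Reduced

variable {ι H : Type*} {Γ : ι → Type*} [∀ i, Group (Γ i)] [Group H] {θ : ∀ i, H →* Γ i}

/-- `IsReduced θ i j g` states that `g` is the product of a nonempty reduced word whose first letter
lies in `Γ i` and whose last letter lies in `Γ j`. -/
inductive IsReduced (θ : ∀ i, H →* Γ i) : ι → ι → PushoutI θ → Prop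
  | single (i : ι) (x : Γ i) (hx : x ∉ (θ i).range) : IsReduced θ i i (of i x)
  | cons {i k j : ι} (x : Γ i) (g : PushoutI θ) (hx : x ∉ (θ i).range) (hik : i ≠ k)
      (hg : IsReduced θ k j g) : IsReduced θ i j (of i x * g)

namespace IsReduced

variable {i j k l : ι} {g g' : PushoutI θ}

theorem append (hg : IsReduced θ i j g) (hg' : IsReduced θ k l g') (hjk : j ≠ k) :
    IsReduced θ i l (g * g') := by
  induction hg with
  | single i x hx => exact cons x g' hx hjk hg'
  | cons x g hx hik _ ih =>
    rw [mul_assoc]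
    exact cons x _ hx hik (ih hjk)

theorem inv (hg : IsReduced θ i j g) : IsReduced θ j i g⁻¹ := by
  induction hg with
  | single i x hx =>
    rw [← map_inv]
    exact single i _ (by simpa using hx)
  | @cons i k j x g hx hik _ ih =>
    rw [mul_inv_rev, ← map_inv]
    exact ih.append (single i _ (by simpa using hx)) hik.symm

theorem base_mul (hg : IsReduced θ i j g) (h : H) : IsReduced θ i j (base θ h * g) := by
  cases hg with
  | single _ x hx =>
    rw [← of_apply_eq_base θ i, ← map_mul]
    exact single i _ fun h' ↦ hx ((Subgroup.mul_mem_cancel_left _ (MonoidHom.mem_range.2 ⟨h, rfl⟩)).1 h')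
  | cons x g hx hik hg =>
    rw [← of_apply_eq_base θ i, ← mul_assoc, ← map_mul]
    exact cons _ g (fun h' ↦ hx ((Subgroup.mul_mem_cancel_left _ (MonoidHom.mem_range.2 ⟨h, rfl⟩)).1 h')) hik hg

theorem mul_base (hg : IsReduced θ i j g) (h : H) : IsReduced θ i j (g * base θ h) := by
  have := (hg.inv.base_mul h⁻¹).inv
  simpa using this

theorem exists_first (hg : IsReduced θ i j g) : ∃ x : Γ i, x ∉ (θ i).range ∧
    ((i = j ∧ g = of i x) ∨ ∃ k, i ≠ k ∧ ∃ g', IsReduced θ k j g' ∧ g = of i x * g') := by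
  cases hg with
  | single _ x hx => exact ⟨x, hx, .inl ⟨rfl, rfl⟩⟩
  | cons x g hx hik hg => exact ⟨x, hx, .inr ⟨_, hik, g, hg, rfl⟩⟩

theorem exists_last (hg : IsReduced θ i j g) : ∃ x : Γ j, x ∉ (θ j).range ∧
    ((i = j ∧ g = of j x) ∨ ∃ k, k ≠ j ∧ ∃ g', IsReduced θ i k g' ∧ g = g' * of j x) := by
  obtain ⟨x, hx, ⟨hij, h⟩ | ⟨k, hk, g', hg', h⟩⟩ := hg.inv.exists_first
  · exact ⟨x⁻¹, by simpa using hx, .inl ⟨hij.symm, by rw [map_inv, ← h, inv_inv]⟩⟩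
  · refine ⟨x⁻¹, by simpa using hx, .inr ⟨k, hk.symm, g'⁻¹, hg'.inv, ?_⟩⟩
    rw [map_inv, ← mul_inv_rev, ← h, inv_inv]

theorem exists_word (hg : IsReduced θ i j g) : ∃ w : CoprodI.Word Γ, Reduced θ w ∧
    ofCoprodI w.prod = g ∧ w.fstIdx = some i := by
  have h1 {i} {x : Γ i} (hx : x ∉ (θ i).range) : x ≠ 1 := fun h ↦ hx (h ▸ one_mem _)
  induction hg with
  | single i x hx =>
    refine ⟨.cons x .empty (by simp [CoprodI.Word.fstIdx]) (h1 hx), ?_, ?_, by simp⟩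
    · rintro _ hl
      simp only [CoprodI.Word.cons, CoprodI.Word.empty, List.mem_singleton] at hl
      subst hl
      exact hx
    · rw [CoprodI.Word.prod_cons]
      simp
  | cons x g hx hik _ ih =>
    obtain ⟨w, hw, rfl, hfst⟩ := ih
    refine ⟨.cons x w (by rw [hfst]; simpa using hik.symm) (h1 hx), ?_, ?_, by simp⟩
    · rintro _ hl
      rcases List.mem_cons.1 hl with rfl | hl
      · exact hx
      · exact hw _ hl
    · rw [CoprodI.Word.prod_cons]
      simp

theorem notMem_range_base (hθ : ∀ i, Function.Injective (θ i)) (hg : IsReduced θ i j g) :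
    g ∉ (base θ).range := by
  obtain ⟨w, hw, rfl, hfst⟩ := hg.exists_word
  intro h
  rw [hw.eq_empty_of_mem_range hθ h] at hfst
  simp [CoprodI.Word.fstIdx] at hfst

/-- With different first factors, `g⁻¹ * g` would be a nonempty reduced product equal to `1`,
against the normal form theorem. -/
theorem first_unique (hθ : ∀ i, Function.Injective (θ i)) (hg : IsReduced θ i j g)
    (hg' : IsReduced θ k l g) : i = k := by
  by_contra hne
  refine (hg.inv.append hg' hne).notMem_range_base hθ ?_
  rw [inv_mul_cancel]
  exact one_mem _

end IsReduced

theorem mem_range_base_or_isReduced (g : PushoutI θ) :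
    g ∈ (base θ).range ∨ ∃ i j, IsReduced θ i j g := by
  let P (g : PushoutI θ) := g ∈ (base θ).range ∨ ∃ i j, IsReduced θ i j g
  have hbase (h : H) (g : PushoutI θ) (hg : P g) : P (base θ h * g) := by
    rcases hg with hg | ⟨i, j, hg⟩
    · exact .inl (mul_mem ⟨h, rfl⟩ hg)
    · exact .inr ⟨i, j, hg.base_mul h⟩
  suffices H : ∀ g g', P g' → P (g * g') by
    simpa only [mul_one] using H g 1 (.inl (one_mem _))
  intro g
  induction g using PushoutI.induction_on with
  | of i x =>
    intro g' hg'
    by_cases hx : x ∈ (θ i).range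
    · obtain ⟨h, rfl⟩ := hx
      rw [of_apply_eq_base]
      exact hbase h g' hg'
    rcases hg' with ⟨h, rfl⟩ | ⟨k, j, hg'⟩
    · exact .inr ⟨i, i, (IsReduced.single i x hx).mul_base h⟩
    by_cases hik : i = k
    · subst hik
      obtain ⟨y, hy, ⟨rfl, rfl⟩ | ⟨k, hk, g', hred, rfl⟩⟩ := hg'.exists_first
      · rw [← map_mul]
        by_cases hxy : x * y ∈ (θ i).range
        · obtain ⟨h, hh⟩ := hxy
          rw [← hh, of_apply_eq_base]
          exact .inl ⟨h, rfl⟩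
        · exact .inr ⟨i, i, .single i _ hxy⟩
      · rw [← mul_assoc, ← map_mul]
        by_cases hxy : x * y ∈ (θ i).range
        · obtain ⟨h, hh⟩ := hxy
          rw [← hh, of_apply_eq_base]
          exact hbase h g' (.inr ⟨k, j, hred⟩)
        · exact .inr ⟨i, j, .cons _ _ hxy hk hred⟩
    · exact .inr ⟨i, j, .cons x g' hx hik hg'⟩
  | base h => exact hbase h
  | mul x y hx hy =>
    intro g' hg'
    rw [mul_assoc]
    exact hx _ (hy _ hg')

end Reduced

/-! ### The half-space of an amalgam -/

section HalfSpace

variable {H : Type*} {Γ : Bool → Type*} [∀ i, Group (Γ i)] [Group H] {θ : ∀ i, H →* Γ i}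

/-- The elements of an amalgamated product of two groups whose reduced forms do not begin with a
letter from the first factor. -/
def halfSpace (θ : ∀ i, H →* Γ i) : Set (PushoutI θ) := {g | ∀ j, ¬ IsReduced θ false j g}

theorem notMem_halfSpace {g : PushoutI θ} : g ∉ halfSpace θ ↔ ∃ j, IsReduced θ false j g := by
  simp only [halfSpace, Set.mem_ofPred_eq, not_forall, not_not]

theorem one_mem_halfSpace (hθ : ∀ i, Function.Injective (θ i)) : 1 ∈ halfSpace θ :=
  fun _ h ↦ h.notMem_range_base hθ (one_mem _)

namespace IsReduced

variable {i j : Bool} {u x : PushoutI θ}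

theorem mem_halfSpace (hθ : ∀ i, Function.Injective (θ i)) (hu : IsReduced θ true j u) :
    u ∈ halfSpace θ :=
  fun _ h ↦ Bool.false_ne_true (h.first_unique hθ hu)

theorem mul_of_mem_halfSpace (hu : IsReduced θ i false u) (hx : x ∈ halfSpace θ) :
    ∃ j, IsReduced θ i j (u * x) := by
  rcases mem_range_base_or_isReduced x with ⟨h, rfl⟩ | ⟨k, j, hk⟩
  · exact ⟨_, hu.mul_base h⟩
  · rcases k with _ | _
    · exact absurd hk (hx j)
    · exact ⟨j, hu.append hk Bool.false_ne_true⟩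

theorem mul_of_notMem_halfSpace (hu : IsReduced θ i true u) (hx : x ∉ halfSpace θ) :
    ∃ j, IsReduced θ i j (u * x) := by
  obtain ⟨j, hj⟩ := notMem_halfSpace.1 hx
  exact ⟨j, hu.append hj Bool.false_ne_true.symm⟩

theorem mul_notMem_halfSpace (hu : IsReduced θ false false u) (hx : x ∈ halfSpace θ) :
    u * x ∉ halfSpace θ :=
  notMem_halfSpace.2 (hu.mul_of_mem_halfSpace hx)

theorem mul_mem_halfSpace (hθ : ∀ i, Function.Injective (θ i)) (hu : IsReduced θ true true u)
    (hx : x ∉ halfSpace θ) : u * x ∈ halfSpace θ :=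
  have ⟨_, h⟩ := hu.mul_of_notMem_halfSpace hx
  h.mem_halfSpace hθ

end IsReduced

/-- Some translate of the half-space inside itself is moved off itself by `u`. -/
def MovesHalfSpace (u : PushoutI θ) : Prop :=
  ∃ g : PushoutI θ, (∀ x ∈ halfSpace θ, g * x ∈ halfSpace θ) ∧
    ∀ x ∈ halfSpace θ, g⁻¹ * u * g * x ∉ halfSpace θ

theorem IsReduced.movesHalfSpace {u : PushoutI θ} (hu : IsReduced θ false false u) :
    MovesHalfSpace u :=
  ⟨1, by simp, fun x hx ↦ by simpa using hu.mul_notMem_halfSpace hx⟩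

theorem MovesHalfSpace.inv {u : PushoutI θ} (hu : MovesHalfSpace u) : MovesHalfSpace u⁻¹ := by
  obtain ⟨g, hg, hg'⟩ := hu
  refine ⟨g, hg, fun x hx h ↦ hg' _ h ?_⟩
  have : g⁻¹ * u * g * (g⁻¹ * u⁻¹ * g * x) = x := by group
  rwa [this]

/-- Conjugating by a product of a letter of the second and a letter of the first factor. -/
theorem MovesHalfSpace.of_conj (hθ : ∀ i, Function.Injective (θ i)) {u v : PushoutI θ}
    {b : Γ true} (hb : b ∉ (θ true).range) {a : Γ false} (ha : a ∉ (θ false).range)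
    (hv : MovesHalfSpace v) (huv : (of true b * of false a)⁻¹ * u * (of true b * of false a) = v) :
    MovesHalfSpace u := by
  subst huv
  obtain ⟨g, hg, hg'⟩ := hv
  refine ⟨of true b * of false a * g, fun x hx ↦ ?_, fun x hx h ↦ hg' x hx ?_⟩
  · rw [mul_assoc, mul_assoc]
    exact (IsReduced.single _ _ hb).mul_mem_halfSpace hθ
      ((IsReduced.single _ _ ha).mul_notMem_halfSpace (hg x hx))
  · rw [mul_inv_rev] at h
    simpa only [mul_assoc] using h

/-- The conditions on an amalgamated product of two groups under which it acts on its Bass–Serre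
tree with enough freedom: some path of length two has trivial stabilizer, and the vertices of the
two kinds have at least three and at least two neighbours. -/
structure IsFreeEnough (θ : ∀ i, H →* Γ i) : Prop where
  injective : ∀ i, Function.Injective (θ i)
  exists_notMem : ∃ b, b ∉ (θ true).range
  exists_malnormal : ∃ a, a ∉ (θ false).range ∧ ∀ h, a⁻¹ * θ false h * a ∈ (θ false).range → h = 1
  exists_third : ∀ c, ∃ a, a ∉ (θ false).range ∧ c * a ∉ (θ false).range

/-- Conjugation by `b * a` yields a word beginning and ending in the first factor. If `b⁻¹ * y * b`
falls into `H`, malnormality keeps its conjugate by `a` outside `H`. -/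
theorem IsFreeEnough.movesHalfSpace_of_true (hF : IsFreeEnough θ) {y : Γ true} (hy : y ≠ 1) :
    MovesHalfSpace (of true y : PushoutI θ) := by
  obtain ⟨b, hb⟩ := hF.exists_notMem
  obtain ⟨a, ha, hfree⟩ := hF.exists_malnormal
  refine .of_conj hF.injective hb ha (IsReduced.movesHalfSpace ?_) rfl
  have heq : (of true b * of false a)⁻¹ * of true y * (of true b * of false a) =
      (of false a⁻¹ * of true (b⁻¹ * y * b) * of false a : PushoutI θ) := by
    simp only [map_mul, map_inv]
    group
  rw [heq]
  by_cases hy' : b⁻¹ * y * b ∈ (θ true).range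
  · obtain ⟨h, hh⟩ := hy'
    rw [← hh, of_apply_eq_base, ← of_apply_eq_base θ false, ← map_mul, ← map_mul]
    refine .single _ _ fun h' ↦ hy ?_
    rw [hfree h h', map_one] at hh
    rw [mul_assoc, eq_comm, inv_mul_eq_one] at hh
    exact mul_eq_right.1 hh.symm
  · exact ((IsReduced.single false a⁻¹ (by simpa using ha)).append (.single _ _ hy')
      Bool.false_ne_true).append (.single _ _ ha) Bool.false_ne_true.symm

theorem IsFreeEnough.movesHalfSpace_of_false (hF : IsFreeEnough θ) {y : Γ false} (hy : y ≠ 1) :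
    MovesHalfSpace (of false y : PushoutI θ) := by
  by_cases hy' : y ∈ (θ false).range
  · obtain ⟨h, rfl⟩ := hy'
    rw [of_apply_eq_base, ← of_apply_eq_base θ true]
    refine hF.movesHalfSpace_of_true fun h' ↦ hy ?_
    rw [(map_eq_one_iff _ (hF.injective true)).1 h', map_one]
  · exact (IsReduced.single _ _ hy').movesHalfSpace

/-- A third coset allows `a` to avoid both `H` and the coset that would absorb the last letter. -/
theorem IsFreeEnough.exists_mul_isReduced (hF : IsFreeEnough θ) {i : Bool} {u : PushoutI θ}
    (hu : IsReduced θ i false u) :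
    ∃ a, a ∉ (θ false).range ∧ IsReduced θ i false (u * of false a) := by
  obtain ⟨c, hc, ⟨rfl, rfl⟩ | ⟨k, hk, u', hu', rfl⟩⟩ := hu.exists_last
  · obtain ⟨a, ha, hca⟩ := hF.exists_third c
    exact ⟨a, ha, by rw [← map_mul]; exact .single _ _ hca⟩
  · obtain ⟨a, ha, hca⟩ := hF.exists_third c
    exact ⟨a, ha, by rw [mul_assoc, ← map_mul]; exact hu'.append (.single _ _ hca) hk⟩

theorem IsFreeEnough.movesHalfSpace_of_isReduced_false_true (hF : IsFreeEnough θ)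
    {u : PushoutI θ} (hu : IsReduced θ false true u) : MovesHalfSpace u := by
  obtain ⟨b, hb, ⟨h, -⟩ | ⟨k, hk, u', hu', rfl⟩⟩ := hu.exists_last
  · exact absurd h Bool.false_ne_true
  obtain rfl : k = false := by simpa using hk
  obtain ⟨a, ha, hua⟩ := hF.exists_mul_isReduced hu'
  -- Conjugating `u' * b` by `b⁻¹ * a` moves `b` to the front: `a⁻¹ * b * (u' * a)`.
  refine .of_conj hF.injective (b := b⁻¹) (by simpa using hb) ha
    (((IsReduced.single false a⁻¹ (by simpa using ha)).append (.single _ _ hb)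
      Bool.false_ne_true).append hua Bool.false_ne_true.symm).movesHalfSpace ?_
  simp only [map_inv]
  group

theorem IsFreeEnough.movesHalfSpace_of_isReduced_true_true (hF : IsFreeEnough θ)
    {u : PushoutI θ} (hu : IsReduced θ true true u) : MovesHalfSpace u := by
  have hu1 : u ≠ 1 := fun h ↦ hu.notMem_range_base hF.injective (h ▸ one_mem _)
  obtain ⟨b₁, hb₁, ⟨-, rfl⟩ | ⟨k, hk, u, hu, rfl⟩⟩ := hu.exists_first
  · exact hF.movesHalfSpace_of_true fun h ↦ hb₁ (h ▸ one_mem _)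
  obtain rfl : k = false := by simpa using hk.symm
  obtain ⟨b₂, hb₂, ⟨h, -⟩ | ⟨k, hk, u, hu, rfl⟩⟩ := hu.exists_last
  · exact absurd h Bool.false_ne_true
  obtain rfl : k = false := by simpa using hk
  obtain ⟨a, ha, hua⟩ := hF.exists_mul_isReduced hu.inv
  replace hua := hua.inv
  rw [mul_inv_rev, inv_inv] at hua
  set w := (of false a)⁻¹ * u with hw
  have heq : (of true b₁ * of false a)⁻¹ * (of true b₁ * (u * of true b₂)) *
      (of true b₁ * of false a) = w * of true (b₂ * b₁) * of false a := by
    rw [hw, map_mul]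
    group
  refine .of_conj hF.injective hb₁ ha ?_ heq
  -- If `b₂ * b₁` lies in `H`, the final `a` merges with the last letter of `w`; each outcome is
  -- nontrivial and of a type already treated.
  by_cases hb : b₂ * b₁ ∈ (θ true).range
  · obtain ⟨h, hh⟩ := hb
    have hne : w * base θ h * of false a ≠ 1 := by
      rw [← of_apply_eq_base θ true, hh, ← heq]
      intro h
      rw [mul_assoc, inv_mul_eq_one] at h
      exact hu1 (mul_eq_right.1 h.symm)
    rw [← hh, of_apply_eq_base]
    obtain ⟨c, hc, ⟨-, h⟩ | ⟨k, hk, w', hw', h⟩⟩ := (hua.mul_base h).exists_last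
    · rw [h, ← map_mul] at hne ⊢
      exact hF.movesHalfSpace_of_false fun h ↦ hne (by rw [h, map_one])
    · obtain rfl : k = true := by simpa using hk
      rw [h, mul_assoc, ← map_mul]
      by_cases hca : c * a ∈ (θ false).range
      · obtain ⟨h', hh'⟩ := hca
        rw [← hh', of_apply_eq_base]
        exact hF.movesHalfSpace_of_isReduced_false_true (hw'.mul_base h')
      · exact (hw'.append (.single _ _ hca) hk).movesHalfSpace
  · exact ((hua.append (.single _ _ hb) Bool.false_ne_true).append (.single _ _ ha)
      Bool.false_ne_true.symm).movesHalfSpace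

theorem IsFreeEnough.movesHalfSpace (hF : IsFreeEnough θ) {u : PushoutI θ} (hu : u ≠ 1) :
    MovesHalfSpace u := by
  rcases mem_range_base_or_isReduced u with ⟨h, rfl⟩ | ⟨i, j, h⟩
  · rw [← of_apply_eq_base θ true]
    refine hF.movesHalfSpace_of_true fun h' ↦ hu ?_
    rw [← of_apply_eq_base θ true, h', map_one]
  · rcases i with _ | _ <;> rcases j with _ | _
    · exact h.movesHalfSpace
    · exact hF.movesHalfSpace_of_isReduced_false_true h
    · simpa using (hF.movesHalfSpace_of_isReduced_false_true h.inv).inv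
    · exact hF.movesHalfSpace_of_isReduced_true_true h

end HalfSpace

/-! ### Enough disjoint translates -/

section Cardinality

variable {H : Type u} {Γ : Bool → Type u} [∀ i, Group (Γ i)] [Group H] {θ : ∀ i, H →* Γ i}

/-- A family of pairwise disjoint translates of the half-space. -/
def DisjointTranslates {ι : Type*} (c : ι → PushoutI θ) : Prop :=
  ∀ s t, s ≠ t → ∀ x ∈ halfSpace θ, ∀ y ∈ halfSpace θ, c s * x ≠ c t * y

theorem disjointTranslates_false :
    DisjointTranslates fun q : Γ false ⧸ (θ false).range ↦ (of false q.out : PushoutI θ) := by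
  intro s t hst x hx y hy h
  refine (IsReduced.single false ((t.out : Γ false)⁻¹ * s.out)
    fun h' ↦ hst ?_).mul_notMem_halfSpace hx ?_
  · simpa using (QuotientGroup.eq.2 h').symm
  · rw [map_mul, map_inv, mul_assoc, h, inv_mul_cancel_left]
    exact hy

theorem disjointTranslates_true (hθ : ∀ i, Function.Injective (θ i)) {a : Γ false}
    (ha : a ∉ (θ false).range) : DisjointTranslates fun q : Γ true ⧸ (θ true).range ↦
      (of true q.out * of false a : PushoutI θ) := by
  intro s t hst x hx y hy h
  have ha' := IsReduced.single false a ha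
  refine ha'.mul_notMem_halfSpace hy ?_
  have := (IsReduced.single true ((t.out : Γ true)⁻¹ * s.out) fun h' ↦ hst (by
    simpa using (QuotientGroup.eq.2 h').symm)).mul_mem_halfSpace hθ (ha'.mul_notMem_halfSpace hx)
  rwa [map_mul, map_inv, mul_assoc, ← mul_assoc (of true s.out), h, mul_assoc,
    inv_mul_cancel_left] at this

/-- `σ X` and `τ X` are disjoint subsets of `X` because `a⁻¹ * a' ∉ H`, so the sets `σ ^ n τ X` are
pairwise disjoint. -/
theorem IsFreeEnough.exists_disjointTranslates_nat (hF : IsFreeEnough θ) :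
    ∃ c : ℕ → PushoutI θ, DisjointTranslates c := by
  obtain ⟨b, hb⟩ := hF.exists_notMem
  obtain ⟨a, ha, -⟩ := hF.exists_malnormal
  obtain ⟨a', ha', haa'⟩ := hF.exists_third a⁻¹
  set σ : PushoutI θ := of true b * of false a
  set τ : PushoutI θ := of true b * of false a'
  have hba {a : Γ false} (ha : a ∉ (θ false).range) {x} (hx : x ∈ halfSpace θ) :
      of true b * of false a * x ∈ halfSpace θ := by
    rw [mul_assoc]
    exact (IsReduced.single _ _ hb).mul_mem_halfSpace hF.injective
      ((IsReduced.single _ _ ha).mul_notMem_halfSpace hx)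
  have hστ {x y} (hx : x ∈ halfSpace θ) (hy : y ∈ halfSpace θ) : σ * x ≠ τ * y := by
    intro h
    refine (IsReduced.single _ _ haa').mul_notMem_halfSpace hy ?_
    rw [mul_assoc, mul_assoc, mul_left_cancel_iff] at h
    rw [map_mul, map_inv, mul_assoc, ← h, inv_mul_cancel_left]
    exact hx
  have hpow (n : ℕ) {x} (hx : x ∈ halfSpace θ) : σ ^ n * x ∈ halfSpace θ := by
    induction n with
    | zero => simpa using hx
    | succ n ih =>
      rw [pow_succ', mul_assoc]
      exact hba ha ih
  have hlt (m n : ℕ) {x y} (hx : x ∈ halfSpace θ) (hy : y ∈ halfSpace θ) :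
      σ ^ (m + n + 1) * τ * x ≠ σ ^ m * τ * y := by
    rw [add_assoc, pow_add, mul_assoc (σ ^ m), mul_assoc (σ ^ m), mul_assoc (σ ^ m), Ne,
      mul_left_cancel_iff, pow_succ', mul_assoc σ, mul_assoc σ, mul_assoc (σ ^ n)]
    exact hστ (hpow n (hba ha' hx)) hy
  refine ⟨fun n ↦ σ ^ n * τ, fun s t hst x hx y hy h ↦ ?_⟩
  rcases lt_or_gt_of_ne hst with h' | h'
  · obtain ⟨k, rfl⟩ := Nat.exists_eq_add_of_lt h'
    exact hlt s k hy hx h.symm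
  · obtain ⟨k, rfl⟩ := Nat.exists_eq_add_of_lt h'
    exact hlt t k hx hy h

theorem IsFreeEnough.infinite (hF : IsFreeEnough θ) : Infinite (PushoutI θ) := by
  obtain ⟨c, hc⟩ := hF.exists_disjointTranslates_nat
  refine Infinite.of_injective c fun s t hst ↦ ?_
  by_contra hne
  exact hc s t hne 1 (one_mem_halfSpace hF.injective) 1 (one_mem_halfSpace hF.injective) (by
    rw [hst])

open Cardinal

theorem mk_pushoutI_le {m : Cardinal.{u}} (hm : ℵ₀ ≤ m) (hΓ : ∀ i, #(Γ i) ≤ m) :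
    #(PushoutI θ) ≤ m := by
  have hsurj : Function.Surjective (fun l : List (Σ i, Γ i) ↦
      (l.map fun x ↦ (of x.1 x.2 : PushoutI θ)).prod) := by
    intro g
    induction g using PushoutI.induction_on with
    | of i x => exact ⟨[⟨i, x⟩], by simp⟩
    | base h => exact ⟨[⟨true, θ true h⟩], by simp [of_apply_eq_base]⟩
    | mul x y hx hy =>
      obtain ⟨l, rfl⟩ := hx
      obtain ⟨l', rfl⟩ := hy
      exact ⟨l ++ l', by simp⟩
  refine (mk_le_of_surjective hsurj).trans ((mk_list_le_max _).trans (max_le hm ?_))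
  rw [mk_sigma]
  refine (sum_le_sum _ (fun _ ↦ m) hΓ).trans ?_
  rw [sum_const]
  exact mul_le_of_le hm (by simpa using (ofNat_lt_aleph0 (n := 2)).le.trans hm) (by simp)

theorem IsFreeEnough.mk_le (hF : IsFreeEnough θ) : #(PushoutI θ) ≤
    max ℵ₀ (max #(Γ true ⧸ (θ true).range) #(Γ false ⧸ (θ false).range)) := by
  set m := max ℵ₀ (max #(Γ true ⧸ (θ true).range) #(Γ false ⧸ (θ false).range)) with hm
  have hm₀ : ℵ₀ ≤ m := le_max_left _ _
  have hquot i : #(Γ i ⧸ (θ i).range) ≤ m := by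
    rcases i with _ | _ <;> simp [hm]
  obtain ⟨a, -, ha⟩ := hF.exists_malnormal
  have hH : #H ≤ m := by
    -- Malnormality makes `h ↦ h a H` injective, so `H` is no larger than its index in the first
    -- factor.
    refine le_trans (mk_le_of_injective (f := fun h ↦
      (QuotientGroup.mk (θ false h * a) : Γ false ⧸ (θ false).range)) fun h h' heq ↦ ?_) (hquot false)
    have := ha (h⁻¹ * h') (by simpa [mul_assoc] using QuotientGroup.eq.1 heq)
    exact inv_mul_eq_one.1 this
  have hΓ i : #(Γ i) ≤ m := by
    rw [mk_congr (Subgroup.groupEquivQuotientProdSubgroup (s := (θ i).range)), mk_prod, lift_id,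
      lift_id]
    refine mul_le_of_le hm₀ (hquot i) (le_trans ?_ hH)
    exact mk_le_of_surjective (θ i).rangeRestrict_surjective
  exact mk_pushoutI_le hm₀ hΓ

theorem IsFreeEnough.exists_disjointTranslates (hF : IsFreeEnough θ) :
    ∃ c : PushoutI θ → PushoutI θ, DisjointTranslates c := by
  obtain ⟨a, ha, -⟩ := hF.exists_malnormal
  have key {ι : Type u} (hι : #(PushoutI θ) ≤ #ι) {c : ι → PushoutI θ}
      (hc : DisjointTranslates c) : ∃ c : PushoutI θ → PushoutI θ, DisjointTranslates c := by
    obtain ⟨e⟩ := hι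
    exact ⟨c ∘ e, fun s t hst ↦ hc _ _ (e.injective.ne hst)⟩
  obtain ⟨c, hc⟩ := hF.exists_disjointTranslates_nat
  rcases le_max_iff.1 hF.mk_le with h | h
  · refine key (ι := ULift.{u} ℕ) (by simpa using h) (c := c ∘ ULift.down) ?_
    exact fun s t hst ↦ hc _ _ (ULift.down_injective.ne hst)
  rcases le_max_iff.1 h with h | h
  · exact key h (disjointTranslates_true hF.injective ha)
  · exact key h disjointTranslates_false

theorem IsFreeEnough.isHalfSpace (hF : IsFreeEnough θ) : IsHalfSpace (halfSpace θ) where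
  compress := by
    obtain ⟨b, hb⟩ := hF.exists_notMem
    exact ⟨of true b, fun g hg ↦ (IsReduced.single _ _ hb).mul_mem_halfSpace hF.injective hg⟩
  wandering _ hu := hF.movesHalfSpace hu
  family := hF.exists_disjointTranslates

end Cardinality

end Monoid.PushoutI

/-! ### From `(†)` to primitivity -/

theorem AmalgamatedProduct.Dagger.isFreeEnough {A B H : Type u} [Group A] [Group B] [Group H]
    {φ : H →* A} {ψ : H →* B} (hφ : Function.Injective φ) (hψ : Function.Injective ψ)
    (h : AmalgamatedProduct.Dagger φ ψ) : Monoid.PushoutI.IsFreeEnough (Amalgam.maps φ ψ) := by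
  obtain ⟨hB, a, a', ha, ha', haa', hmal⟩ := h
  have hmal' (h : H) (hh : a⁻¹ * φ h * a ∈ φ.range) : h = 1 := by
    have : a⁻¹ * φ h * a ∈ φ.range.map (MulAut.conj a⁻¹).toMonoidHom ⊓ φ.range :=
      ⟨⟨φ h, ⟨h, rfl⟩, by simp⟩, hh⟩
    rw [hmal, Subgroup.mem_bot, mul_assoc, inv_mul_eq_one, eq_comm, mul_eq_right] at this
    exact (map_eq_one_iff _ hφ).1 this
  refine ⟨?_, ?_, ⟨a, ha, hmal'⟩, ?_⟩
  · rintro (_ | _)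
    exacts [hφ, hψ]
  · by_contra! h
    exact hB (eq_top_iff.2 fun b _ ↦ h b)
  · change ∀ c : A, ∃ x : A, x ∉ φ.range ∧ c * x ∉ φ.range
    by_contra! ⟨c, hc⟩
    -- Without a third coset, products of two elements outside `H` lie in `H`. Then `a⁻¹ * (h * a) ∈
    -- H` makes `H` trivial, and `a * a' ∈ H` contradicts `a * a' ≠ 1`.
    have hmul {x y : A} (hx : x ∉ φ.range) (hy : y ∉ φ.range) : x * y ∈ φ.range := by
      have := mul_mem (inv_mem (hc x⁻¹ (by simpa using hx))) (hc y hy)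
      simpa [mul_assoc] using this
    have hH (h : H) : h = 1 := by
      refine hmal' h ?_
      rw [mul_assoc]
      exact hmul (by simpa using ha) fun h' ↦ ha ((Subgroup.mul_mem_cancel_left _ (MonoidHom.mem_range.2 ⟨h, rfl⟩)).1 h')
    obtain ⟨h, hh⟩ := hmul ha ha'
    exact haa' (by rw [← hh, hH h, map_one])

theorem corollary4p5 {A B H : Type u} [Group A] [Group B] [Group H]
    (φ : H →* A) (ψ : H →* B) (hφ : Function.Injective φ) (hψ : Function.Injective ψ)
    (hdagger : AmalgamatedProduct.Dagger φ ψ) :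
    (∀ (R : Type v) [Ring R] [IsDomain R],
      Cardinal.lift.{u} (Cardinal.mk R) ≤ Cardinal.lift.{v} (Cardinal.mk (AmalgamatedProduct φ ψ)) →
        IsRightPrimitive (MonoidAlgebra R (AmalgamatedProduct φ ψ))) ∧
    (∀ (K : Type w) [Field K],
      IsRightPrimitive (MonoidAlgebra K (AmalgamatedProduct φ ψ))) := by
  have hF := hdagger.isFreeEnough hφ hψ
  have := hF.infinite
  exact ⟨fun R _ _ hR ↦ hF.isHalfSpace.isRightPrimitive_of_card_le hR,
    fun K _ ↦ hF.isHalfSpace.isRightPrimitive_of_field⟩
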